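/- Let $n \ge 1$. Let $L_n$ be the linear octagonal-quadrilateral network with $n$ octagons and $n$ quadrilaterals in alternation: the simple graph on the $8n+2$ vertices $1, 2, \dots, 4n+1, 1', 2', \dots, (4n+1)'$ whose edges are $\{i, i+1\}$ and $\{i', (i+1)'\}$ for $1 \le i \le 4n$, together with the rungs $\{i, i'\}$ for those $i \in \{1, \dots, 4n+1\}$ with $i \equiv 0$ or $1 \pmod 4$. Let $Q_n$ be the linear crossed octagonal-quadrilateral network, obtained from $L_n$ by adding the edges $\{i, (i+1)'\}$ and $\{i', i+1\}$ for $1 \le i \le 4n$. Then the number $\tau(Q_n)$ of spanning trees of $Q_n$ is $$\tau(Q_n) = 2^{10n+2} \cdot 3^{2n-1}.$$ -/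

import Mathlib

/-- The vertices of the networks: `(k, false)` is the vertex labelled `k + 1` and `(k, true)` is the
vertex labelled `(k + 1)'`, where `0 ≤ k ≤ 4 n`. -/
abbrev NetworkVertex (n : ℕ) : Type := Fin (4 * n + 1) × Bool

/-- The linear octagonal-quadrilateral network with `n` octagons and `n` quadrilaterals in
alternation. Its edges are those of the two paths `1, 2, …, 4n+1` and `1', 2', …, (4n+1)'`, and the
rungs joining `i` to `i'` for the labels `i ≡ 0, 1 (mod 4)`, that is `i = 1, 4, 5, 8, 9, …, 4n, 4n+1`.
Between the rungs at `4j+1` and `4j+4` there is an octagon, and between those at `4j+4` and `4j+5` a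
quadrilateral. (The label of `(k, _)` is `k + 1`.) -/
def linearNetwork (n : ℕ) : SimpleGraph (NetworkVertex n) :=
  SimpleGraph.fromRel fun u v =>
    (u.2 = v.2 ∧ v.1.val = u.1.val + 1) ∨
    (u.2 ≠ v.2 ∧ u.1 = v.1 ∧ ((u.1.val + 1) % 4 = 0 ∨ (u.1.val + 1) % 4 = 1))

/-- The crossing edges: `i` is joined to `(i+1)'` and `i'` is joined to `i+1`, for `1 ≤ i ≤ 4n`. -/
def crossEdges (n : ℕ) : SimpleGraph (NetworkVertex n) :=
  SimpleGraph.fromRel fun u v => u.2 ≠ v.2 ∧ v.1.val = u.1.val + 1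

/-- The linear crossed octagonal-quadrilateral network `Q_n`. -/
def crossedNetwork (n : ℕ) : SimpleGraph (NetworkVertex n) :=
  linearNetwork n ⊔ crossEdges n

/-- The number of spanning trees of `G`: trees on all the vertices of `G` whose edges are edges
of `G`. -/
noncomputable def numSpanningTrees {V : Type*} (G : SimpleGraph V) : ℕ :=
  Set.ncard {T : SimpleGraph V | T ≤ G ∧ T.IsTree}

/-! Swapping `i` and `i'` is a symmetry of `Q_n`. On symmetric vectors the rungs cancel and the
Laplacian becomes twice that of a path; on antisymmetric vectors the path and crossing edges cancel
and it becomes diagonal, with entries `4` or `6` inside and `4` at both ends. The Laplacian is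
singular, so `2 (e_s + e_t)` is added to the row of `s`, where `s`, `t` are the two copies of the
first vertex. By the matrix-tree theorem the determinant becomes `4 τ`
(`det_lapMatrix_updateRow_add`), and it factors (`det_fromBlocks_add_left`) into a symmetric part `2
^ (4n+1)`, by `one_sub_shift_mul_transpose`, and the product of the diagonal entries. -/

namespace SimpleGraph

/-! ### Rooted trees as parent functions. -/

variable {V : Type*}

/-- The graph in which every vertex `v` is joined to its parent `p v`. -/
def parentGraph (p : V → V) : SimpleGraph V := fromRel fun u v => p u = v

lemma parentGraph_adj {p : V → V} {u v : V} :
    (parentGraph p).Adj u v ↔ u ≠ v ∧ (p u = v ∨ p v = u) := by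
  simp [parentGraph, fromRel_adj]

lemma parentGraph_connected {p : V → V} {r : V} (h : ∀ v, ∃ k, p^[k] v = r) :
    (parentGraph p).Connected := by
  have key : ∀ k v, p^[k] v = r → (parentGraph p).Reachable v r := by
    intro k
    induction k with
    | zero => rintro v rfl; exact Reachable.refl _
    | succ k ih =>
      intro v hv
      rw [Function.iterate_succ_apply] at hv
      by_cases hpv : v = p v
      · rw [hpv]; exact ih _ hv
      · exact (Adj.reachable (parentGraph_adj.2 ⟨hpv, Or.inl rfl⟩)).trans (ih _ hv)
  have : Nonempty V := ⟨r⟩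
  refine ⟨fun u v => ?_⟩
  obtain ⟨k, hk⟩ := h u
  obtain ⟨l, hl⟩ := h v
  exact (key k u hk).trans (key l v hl).symm

/-- Only the vertices other than `r` contribute an edge, so this connected graph has at most `|V| -
1` edges. -/
lemma parentGraph_isTree [Finite V] {p : V → V} {r : V} (hr : p r = r)
    (h : ∀ v, ∃ k, p^[k] v = r) : (parentGraph p).IsTree := by
  have hc := parentGraph_connected h
  refine isTree_iff_connected_and_card.2 ⟨hc, le_antisymm ?_ hc.card_vert_le_card_edgeSet_add_one⟩
  have hsub : (parentGraph p).edgeSet ⊆ (fun v => s(v, p v)) '' {r}ᶜ := by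
    intro e
    induction e with
    | _ u v =>
      intro he
      obtain ⟨hne, h | h⟩ := parentGraph_adj.1 ((mem_edgeSet _).1 he) <;> subst h
      · exact ⟨u, fun hu => hne (by rw [Set.mem_singleton_iff.1 hu, hr]), rfl⟩
      · exact ⟨v, fun hv => hne (by rw [Set.mem_singleton_iff.1 hv, hr]), Sym2.eq_swap⟩
  have h1 : (parentGraph p).edgeSet.ncard ≤ ({r}ᶜ : Set V).ncard :=
    (Set.ncard_le_ncard hsub (Set.toFinite _)).trans (Set.ncard_image_le (Set.toFinite _))
  have h2 := Set.ncard_add_ncard_compl ({r} : Set V)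
  rw [Set.ncard_singleton] at h2
  change (parentGraph p).edgeSet.ncard + 1 ≤ _
  omega

lemma parentGraph_injective {p q : V → V} {r : V} (hp : p r = r) (hq : q r = r)
    (hpr : ∀ v, v ≠ r → p v ≠ v) (h : ∀ v, ∃ k, p^[k] v = r)
    (hpq : parentGraph p = parentGraph q) : p = q := by
  have key : ∀ k v, p^[k] v = r → p v = q v := by
    intro k
    induction k with
    | zero => rintro v rfl; exact hp.trans hq.symm
    | succ k ih =>
      intro v hv
      by_contra hne
      have hvr : v ≠ r := by rintro rfl; exact hne (hp.trans hq.symm)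
      have hadj : (parentGraph q).Adj v (p v) :=
        hpq ▸ parentGraph_adj.2 ⟨(hpr v hvr).symm, Or.inl rfl⟩
      have hqv : q (p v) = v := (parentGraph_adj.1 hadj).2.resolve_left (Ne.symm hne)
      have hpp : p (p v) = v := (ih (p v) (by rwa [Function.iterate_succ_apply] at hv)).trans hqv
      -- If `p v ≠ q v`, the edge from `v` to `p v` forces `v` and `p v` into a 2-cycle of `p`,
      -- which cannot lead to the fixed point `r`.
      have hcyc : ∀ j, p^[j] v = v ∨ p^[j] v = p v := by
        intro j
        induction j with
        | zero => exact Or.inl rfl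
        | succ j ihj =>
          rw [Function.iterate_succ_apply']
          rcases ihj with hj | hj <;> rw [hj]
          · exact Or.inr rfl
          · exact Or.inl hpp
      rcases hcyc (k + 1) with hj | hj
      · exact hvr (hj.symm.trans hv)
      · have hpv : p v = r := hj.symm.trans hv
        rw [hpv, hp] at hpp
        exact hvr hpp.symm
  funext v
  obtain ⟨k, hk⟩ := h v
  exact key k v hk

lemma IsTree.exists_parentGraph_eq [Finite V] {T : SimpleGraph V} (hT : T.IsTree) (r : V) :
    ∃ p : V → V, p r = r ∧ (∀ v, v ≠ r → T.Adj v (p v)) ∧ (∀ v, ∃ k, p^[k] v = r) ∧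
      parentGraph p = T := by
  classical
  -- The parent of `v` is the next vertex on a geodesic to `r`.
  have step : ∀ v, v ≠ r → ∃ w, T.Adj v w ∧ T.dist w r < T.dist v r := by
    intro v hv
    obtain ⟨w, hw⟩ := (hT.connected v r).exists_walk_length_eq_dist
    cases w with
    | nil => exact absurd rfl hv
    | cons hadj w' =>
      refine ⟨_, hadj, ?_⟩
      have := dist_le w'
      rw [Walk.length_cons] at hw
      omega
  choose! f hf hd using step
  let p : V → V := fun v => if v = r then r else f v
  have hpr : p r = r := if_pos rfl
  have hpv : ∀ v, v ≠ r → p v = f v := fun v hv => if_neg hv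
  have hreach : ∀ v, ∃ k, p^[k] v = r := by
    intro v
    induction hn : T.dist v r using Nat.strong_induction_on generalizing v with
    | _ n ih =>
      by_cases hv : v = r
      · exact ⟨0, hv⟩
      · obtain ⟨k, hk⟩ := ih _ (hn ▸ hd v hv) (f v) rfl
        exact ⟨k + 1, by rw [Function.iterate_succ_apply, hpv v hv, hk]⟩
  have hadj : ∀ v, v ≠ r → T.Adj v (p v) := fun v hv => by rw [hpv v hv]; exact hf v hv
  refine ⟨p, hpr, hadj, hreach, ?_⟩
  have hle : parentGraph p ≤ T := by
    intro u v huv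
    obtain ⟨hne, rfl | rfl⟩ := parentGraph_adj.1 huv
    · exact hadj u fun hu => hne (by rw [hu, hpr])
    · exact (hadj v fun hv => hne (by rw [hv, hpr])).symm
  exact le_antisymm hle ((isTree_iff_minimal_connected.1 hT).2 (parentGraph_connected hreach) hle)

/-! ### The matrix-tree theorem. -/

variable [Fintype V] [DecidableEq V]

/-- The rows `e_v - e_{p v}` for `v ≠ r`, and the row `e_r`. -/
def parentMatrix (r : V) (p : V → V) : Matrix V V ℤ :=
  Matrix.of fun v => if v = r then Pi.single r 1 else Pi.single v 1 - Pi.single (p v) 1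

omit [Fintype V] in
lemma parentMatrix_row_ne {r v : V} {p : V → V} (hv : v ≠ r) :
    parentMatrix r p v = Pi.single v 1 - Pi.single (p v) 1 :=
  if_neg hv

/-- Parents have smaller depth `d`, so ordering by depth makes the matrix triangular with identity
diagonal blocks. -/
lemma det_parentMatrix_of_reach {r : V} {p : V → V} (h : ∀ v, ∃ k, p^[k] v = r) :
    (parentMatrix r p).det = 1 := by
  let d : V → ℕ := fun v => Nat.find (h v)
  have hd : ∀ v, v ≠ r → d (p v) < d v := by
    intro v hv
    have hspec : p^[d v] v = r := Nat.find_spec (h v)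
    obtain ⟨k, hk⟩ : ∃ k, d v = k + 1 := by
      refine Nat.exists_eq_succ_of_ne_zero fun h0 => hv ?_
      rwa [h0] at hspec
    rw [hk, Function.iterate_succ_apply] at hspec
    have : d (p v) ≤ k := Nat.find_min' _ hspec
    omega
  have hentry : ∀ v w, d v ≤ d w → parentMatrix r p v w = if v = w then 1 else 0 := by
    intro v w hvw
    by_cases hv : v = r
    · subst hv
      simp [parentMatrix, Pi.single_apply, eq_comm]
    · have : w ≠ p v := by
        rintro rfl
        exact absurd (hd v hv) (not_lt.2 hvw)
      rw [parentMatrix_row_ne hv]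
      simp [Pi.single_apply, this, eq_comm]
  have htri : (parentMatrix r p).BlockTriangular (OrderDual.toDual ∘ d) := by
    intro v w hvw
    have hlt : d v < d w := hvw
    rw [hentry v w hlt.le, if_neg]
    rintro rfl
    exact lt_irrefl _ hlt
  rw [htri.det]
  refine Finset.prod_eq_one fun k _ => ?_
  have hblock : (parentMatrix r p).toSquareBlock (OrderDual.toDual ∘ d) k = 1 := by
    ext ⟨v, hv⟩ ⟨w, hw⟩
    have hvw : d v = d w := OrderDual.toDual.injective (hv.trans hw.symm)
    simp [Matrix.toSquareBlock_def, hentry v w hvw.le, Matrix.one_apply]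
  rw [hblock, Matrix.det_one]

lemma det_parentMatrix_of_not_reach {r : V} {p : V → V} (h : ¬ ∀ v, ∃ k, p^[k] v = r) :
    (parentMatrix r p).det = 0 := by
  classical
  push Not at h
  obtain ⟨u, hu⟩ := h
  -- The indicator of the vertices that never reach `r` is in the kernel, being constant along `p`.
  refine Matrix.exists_mulVec_eq_zero_iff.1
    ⟨fun v => if ∃ k, p^[k] v = r then 0 else 1, fun h0 => ?_, ?_⟩
  · have := congrFun h0 u
    simp [hu] at this
  · funext v
    by_cases hv : v = r
    · subst hv
      have : ∃ k, p^[k] v = v := ⟨0, rfl⟩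
      simp [Matrix.mulVec, parentMatrix, this]
    · have : (∃ k, p^[k] v = r) ↔ ∃ k, p^[k] (p v) = r := by
        constructor
        · rintro ⟨_ | k, hk⟩
          · exact absurd hk hv
          · exact ⟨k, hk⟩
        · rintro ⟨k, hk⟩
          exact ⟨k + 1, hk⟩
      rw [Matrix.mulVec, parentMatrix_row_ne hv, sub_dotProduct]
      simp [this]

variable (G : SimpleGraph V) [DecidableRel G.Adj]

lemma lapMatrix_row (v : V) :
    G.lapMatrix ℤ v = ∑ w ∈ G.neighborFinset v, (Pi.single v 1 - Pi.single w 1) := by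
  funext u
  by_cases h : v = u
  · subst h
    simp [lapMatrix, degMatrix, adjMatrix_apply, Finset.sum_apply, Pi.single_apply]
  · simp [lapMatrix, degMatrix, adjMatrix_apply, Finset.sum_apply, Pi.single_apply, h, Ne.symm h]

/-- The matrix-tree theorem. -/
theorem numSpanningTrees_eq_det (r : V) :
    (numSpanningTrees G : ℤ) = ((G.lapMatrix ℤ).updateRow r (Pi.single r 1)).det := by
  classical
  let A : V → Finset V := fun v => if v = r then {r} else G.neighborFinset v
  have hrow : (G.lapMatrix ℤ).updateRow r (Pi.single r 1) = fun v => ∑ w ∈ A v,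
      (if v = r then Pi.single r (1 : ℤ) else Pi.single v 1 - Pi.single w 1) := by
    funext v
    by_cases hv : v = r
    · subst hv
      simp [A]
    · simp only [A, Matrix.updateRow_ne hv, lapMatrix_row, hv, if_false]
  -- Multilinearity in the rows turns the determinant into a sum over all choices of a parent for
  -- each vertex.
  have hexp : ((G.lapMatrix ℤ).updateRow r (Pi.single r 1)).det =
      ∑ p ∈ Fintype.piFinset A, (parentMatrix r p).det := by
    rw [hrow]
    exact MultilinearMap.map_sum_finset (Matrix.detRowAlternating (R := ℤ)).toMultilinearMap
      (fun v w => if v = r then Pi.single r (1 : ℤ) else Pi.single v 1 - Pi.single w 1) A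
  have hdet : ∀ p : V → V,
      (parentMatrix r p).det = if ∀ v, ∃ k, p^[k] v = r then 1 else 0 := by
    intro p
    split_ifs with h
    · exact det_parentMatrix_of_reach h
    · exact det_parentMatrix_of_not_reach h
  rw [hexp]
  simp only [hdet]
  rw [Finset.sum_boole, Nat.cast_inj, ← Set.ncard_coe_finset]
  have hA : ∀ p, p ∈ Fintype.piFinset A ↔ p r = r ∧ ∀ v, v ≠ r → G.Adj v (p v) := by
    intro p
    rw [Fintype.mem_piFinset]
    constructor
    · refine fun h => ⟨by simpa [A] using h r, fun v hv => by simpa [A, hv] using h v⟩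
    · rintro ⟨h1, h2⟩ v
      by_cases hv : v = r
      · subst hv
        simpa [A] using h1
      · simpa [A, hv] using h2 v hv
  refine (Set.ncard_congr (fun p _ => parentGraph p) ?_ ?_ ?_).symm
  · intro p hp
    rw [Finset.mem_coe, Finset.mem_filter, hA] at hp
    obtain ⟨⟨hr, hadj⟩, hreach⟩ := hp
    refine ⟨fun u v huv => ?_, parentGraph_isTree hr hreach⟩
    obtain ⟨hne, rfl | rfl⟩ := parentGraph_adj.1 huv
    · exact hadj u fun hu => hne (by rw [hu, hr])
    · exact (hadj v fun hv => hne (by rw [hv, hr])).symm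
  · intro p q hp hq hpq
    rw [Finset.mem_coe, Finset.mem_filter, hA] at hp hq
    exact parentGraph_injective hp.1.1 hq.1.1 (fun v hv => (hp.1.2 v hv).ne') hp.2 hpq
  · rintro T ⟨hTG, hT⟩
    obtain ⟨p, hr, hadj, hreach, hpT⟩ := hT.exists_parentGraph_eq r
    refine ⟨p, ?_, hpT⟩
    rw [Finset.mem_coe, Finset.mem_filter, hA]
    exact ⟨⟨hr, fun v hv => hTG (hadj v hv)⟩, hreach⟩

lemma det_lapMatrix_updateRow_single (r s : V) :
    ((G.lapMatrix ℤ).updateRow r (Pi.single s 1)).det = numSpanningTrees G := by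
  rw [numSpanningTrees_eq_det G r, ← sub_eq_zero, sub_eq_add_neg, ← neg_one_mul,
    ← Matrix.det_updateRow_smul, ← Matrix.det_updateRow_add]
  -- With row `e_r - e_s` at `r`, every row sums to zero.
  refine Matrix.exists_mulVec_eq_zero_iff.1 ⟨fun _ => 1, fun h => ?_, ?_⟩
  · simpa using congrFun h r
  · funext v
    by_cases hv : v = r
    · subst hv
      rw [Matrix.mulVec, Matrix.updateRow_self, add_dotProduct, smul_dotProduct]
      simp
    · have := congrFun (G.lapMatrix_mulVec_const_eq_zero (R := ℤ)) v
      simpa [Matrix.mulVec, Matrix.updateRow_ne hv] using this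

lemma det_lapMatrix_int_eq_zero [Nonempty V] : (G.lapMatrix ℤ).det = 0 := by
  refine Matrix.exists_mulVec_eq_zero_iff.1 ⟨fun _ => 1, fun h => ?_,
    G.lapMatrix_mulVec_const_eq_zero⟩
  simpa using congrFun h (Classical.arbitrary V)

/-- The determinant of the Laplacian with `a (e_s + e_t)` added to the row of `r`. -/
lemma det_lapMatrix_updateRow_add (r s t : V) (a : ℤ) :
    ((G.lapMatrix ℤ).updateRow r
      (G.lapMatrix ℤ r + a • (Pi.single s 1 + Pi.single t 1))).det =
      2 * a * numSpanningTrees G := by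
  have : Nonempty V := ⟨r⟩
  rw [Matrix.det_updateRow_add, Matrix.det_updateRow_smul, Matrix.det_updateRow_add,
    det_lapMatrix_updateRow_single, det_lapMatrix_updateRow_single, Matrix.updateRow_eq_self,
    det_lapMatrix_int_eq_zero]
  ring

end SimpleGraph

/-! ### Block determinants and the path Laplacian. -/

namespace Matrix

variable {ι R : Type*} [Fintype ι] [DecidableEq ι] [CommRing R]

/-- Add the second block row to the first, then subtract the first block column from the second. -/
lemma det_fromBlocks_add_left (D B K : Matrix ι ι R) :
    (fromBlocks (D + K) (B + K) B D).det = (D + B + K).det * (D - B).det := by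
  have h : fromBlocks 1 1 0 1 * fromBlocks (D + K) (B + K) B D * fromBlocks 1 (-1) 0 1 =
      fromBlocks (D + B + K) 0 B (D - B) := by
    simp only [fromBlocks_multiply]
    congr 1 <;> simp <;> abel
  rw [← det_fromBlocks_zero₁₂ _ B, ← h, det_mul, det_mul, det_fromBlocks_zero₂₁,
    det_fromBlocks_zero₂₁]
  simp

/-- The adjacency matrix of the directed path `0 → 1 → ⋯ → m - 1`. -/
def shift (m : ℕ) : Matrix (Fin m) (Fin m) ℤ := of fun i j => if j.val = i.val + 1 then 1 else 0

lemma det_one_sub_shift (m : ℕ) : (1 - shift m).det = 1 := by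
  rw [det_of_isUpperTriangular]
  · simp [shift]
  · intro i j hij
    have h1 : j < i := hij
    have h2 : ¬ j.val = i.val + 1 := by omega
    simp [shift, h2, h1.ne']

lemma shift_mul_transpose (m : ℕ) :
    shift m * (shift m)ᵀ = diagonal fun i => ∑ j, shift m i j := by
  ext i j
  rw [mul_apply, diagonal_apply]
  split_ifs with h
  · subst h
    exact Finset.sum_congr rfl fun k _ => by simp [shift]
  · refine Finset.sum_eq_zero fun k _ => ?_
    simp only [shift, transpose_apply, of_apply, mul_ite, mul_one, mul_zero]
    split_ifs <;> first | rfl | omega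

lemma sum_shift_row {m : ℕ} (i : Fin m) :
    ∑ j, shift m i j = if i.val + 1 < m then 1 else 0 := by
  split_ifs with h
  · rw [Finset.sum_eq_single ⟨i.val + 1, h⟩] <;> simp [shift, Fin.ext_iff]
  · exact Finset.sum_eq_zero fun j _ => by simp [shift]; omega

lemma sum_shift_col {m : ℕ} (i : Fin m) :
    ∑ j, shift m j i = if i.val = 0 then 0 else 1 := by
  split_ifs with h
  · exact Finset.sum_eq_zero fun j _ => by simp [shift]; omega
  · rw [Finset.sum_eq_single ⟨i.val - 1, by omega⟩]
    · simp [shift]; omega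
    · intro j _ hj
      have : j.val ≠ i.val - 1 := fun h' => hj (Fin.ext h')
      simp [shift]; omega
    · simp

/-- The Laplacian of the path, with the entry at the initial vertex increased by one. -/
lemma one_sub_shift_mul_transpose {m : ℕ} (hm : 0 < m) :
    (1 - shift m) * (1 - shift m)ᵀ =
      diagonal (fun i => ∑ j, (shift m i j + shift m j i)) - (shift m + (shift m)ᵀ) +
        single ⟨0, hm⟩ ⟨0, hm⟩ 1 := by
  rw [transpose_sub, transpose_one, mul_sub, sub_mul, sub_mul, shift_mul_transpose]
  ext i j
  simp only [mul_one, one_mul, sub_apply, add_apply, transpose_apply, diagonal_apply, one_apply,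
    Finset.sum_add_distrib, sum_shift_col, single_apply, Fin.ext_iff]
  split_ifs <;> omega

end Matrix

/-! ### The Laplacian of the crossed network. -/

open Matrix

/-- The indicator of the rungs. -/
def rung (k : ℕ) : ℤ := if (k + 1) % 4 = 0 ∨ (k + 1) % 4 = 1 then 1 else 0

lemma crossedNetwork_adj {n : ℕ} {u v : NetworkVertex n} :
    (crossedNetwork n).Adj u v ↔ (v.1.val = u.1.val + 1 ∨ u.1.val = v.1.val + 1) ∨
      (u.1 = v.1 ∧ u.2 ≠ v.2 ∧ ((u.1.val + 1) % 4 = 0 ∨ (u.1.val + 1) % 4 = 1)) := by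
  obtain ⟨⟨i, hi⟩, b⟩ := u
  obtain ⟨⟨j, hj⟩, c⟩ := v
  simp only [crossedNetwork, linearNetwork, crossEdges, SimpleGraph.sup_adj,
    SimpleGraph.fromRel_adj, ne_eq, Prod.mk.injEq, Fin.mk.injEq]
  by_cases hbc : b = c
  · subst hbc
    simp
    omega
  · simp [hbc, Ne.symm hbc]
    omega

lemma ite_crossedNetwork_adj {n : ℕ} (i j : Fin (4 * n + 1)) (b c : Bool)
    [Decidable ((crossedNetwork n).Adj (i, b) (j, c))] :
    (if (crossedNetwork n).Adj (i, b) (j, c) then (1 : ℤ) else 0) =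
      shift _ i j + shift _ j i + if i = j ∧ b ≠ c then rung i else 0 := by
  rw [if_congr crossedNetwork_adj rfl rfl]
  simp only [shift, rung, of_apply, Fin.ext_iff]
  split_ifs <;> first | rfl | omega | tauto

lemma degree_crossedNetwork {n : ℕ} [DecidableRel (crossedNetwork n).Adj]
    (i : Fin (4 * n + 1)) (b : Bool) :
    ((crossedNetwork n).degree (i, b) : ℤ) =
      2 * ∑ j, (shift _ i j + shift _ j i) + rung i := by
  rw [SimpleGraph.degree_eq_sum_if_adj, Fintype.sum_prod_type]
  simp only [ite_crossedNetwork_adj, Finset.sum_add_distrib, Fintype.sum_bool]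
  cases b <;> simp <;> ring

/-- Each period of four contributes `4 · 4 · 6 · 6 = 576`. -/
lemma prod_four_add_rung (k : ℕ) :
    ∏ i ∈ Finset.range (4 * k), (4 + 2 * rung (i + 1)) = 576 ^ k := by
  induction k with
  | zero => rfl
  | succ k ih =>
    rw [show 4 * (k + 1) = 4 * k + 1 + 1 + 1 + 1 by ring]
    simp only [Finset.prod_range_succ, ih]
    have h0 : rung (4 * k + 1) = 0 := if_neg (by omega)
    have h1 : rung (4 * k + 1 + 1) = 0 := if_neg (by omega)
    have h2 : rung (4 * k + 1 + 1 + 1) = 1 := if_pos (by omega)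
    have h3 : rung (4 * k + 1 + 1 + 1 + 1) = 1 := if_pos (by omega)
    rw [h0, h1, h2, h3]
    ring

/-- Besides the `k` full periods there remain the two ends, `4 · 4`, and three interior factors `4 ·
4 · 6`, which together give `1536`. -/
lemma prod_antisymmetric_eigenvalues (k : ℕ) :
    ∏ i : Fin (4 * (k + 1) + 1), (2 * ∑ j, (shift _ i j + shift _ j i) + 2 * rung i) =
      1536 * 576 ^ k := by
  simp only [Finset.sum_add_distrib, sum_shift_row, sum_shift_col]
  rw [Fin.prod_univ_eq_prod_range (fun i => 2 * ((if i + 1 < 4 * (k + 1) + 1 then (1 : ℤ) else 0) +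
    if i = 0 then 0 else 1) + 2 * rung i), Finset.prod_range_succ,
    show 4 * (k + 1) = 4 * k + 1 + 1 + 1 + 1 by ring, Finset.prod_range_succ',
    Finset.prod_congr rfl (g := fun i => 4 + 2 * rung (i + 1))]
  · simp only [Finset.prod_range_succ, prod_four_add_rung]
    have h0 : rung 0 = 1 := if_pos (by omega)
    have h1 : rung (4 * k + 1) = 0 := if_neg (by omega)
    have h2 : rung (4 * k + 1 + 1) = 0 := if_neg (by omega)
    have h3 : rung (4 * k + 1 + 1 + 1) = 1 := if_pos (by omega)
    have h4 : rung (4 * k + 1 + 1 + 1 + 1) = 1 := if_pos (by omega)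
    rw [h0, h1, h2, h3, h4]
    simp
    ring
  · intro i hi
    have : i < 4 * k + 3 := by simpa using hi
    rw [if_pos (by omega), if_neg (by omega)]
    ring

lemma four_mul_numSpanningTrees_crossedNetwork (n : ℕ) :
    (4 * numSpanningTrees (crossedNetwork n) : ℤ) = 2 ^ (4 * n + 1) *
      ∏ i : Fin (4 * n + 1), (2 * ∑ j, (shift _ i j + shift _ j i) + 2 * rung i) := by
  classical
  let G := crossedNetwork n
  let r : Fin (4 * n + 1) := ⟨0, by omega⟩
  let P := shift (4 * n + 1) + (shift (4 * n + 1))ᵀ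
  let q : Fin (4 * n + 1) → ℤ := fun i => ∑ j, (shift _ i j + shift _ j i)
  let ρ : Fin (4 * n + 1) → ℤ := fun i => rung i
  let D := diagonal (fun i => 2 * q i + ρ i) - P
  let B := -diagonal ρ - P
  let e : Fin (4 * n + 1) ⊕ Fin (4 * n + 1) ≃ NetworkVertex n :=
    (Equiv.boolProdEquivSum _).symm.trans (Equiv.prodComm _ _)
  -- The factor `2` matches the doubled path Laplacian in `D + B`, so that it can be taken out in
  -- `hsymm`.
  have hblocks : ((G.lapMatrix ℤ).updateRow (r, false) (G.lapMatrix ℤ (r, false) +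
      (2 : ℤ) • (Pi.single (r, false) 1 + Pi.single (r, true) 1))).submatrix e e =
      fromBlocks (D + Matrix.single r r 2) (B + Matrix.single r r 2) B D := by
    have hL : ∀ i j b c, G.lapMatrix ℤ (i, b) (j, c) = if b = c then D i j else B i j := by
      intro i j b c
      simp only [SimpleGraph.lapMatrix, SimpleGraph.degMatrix, Matrix.sub_apply, diagonal_apply,
        SimpleGraph.adjMatrix_apply, G, ite_crossedNetwork_adj, degree_crossedNetwork, D, B, P, q,
        ρ, Matrix.add_apply, Matrix.neg_apply, transpose_apply, Prod.mk.injEq]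
      by_cases hij : i = j <;> by_cases hbc : b = c <;> simp [hij, hbc] <;> ring
    have hfalse : ∀ i, e (Sum.inl i) = (i, false) := fun _ => rfl
    have htrue : ∀ i, e (Sum.inr i) = (i, true) := fun _ => rfl
    ext (i | i) (j | j) <;>
      simp only [submatrix_apply, hfalse, htrue, updateRow_apply, fromBlocks_apply₁₁,
        fromBlocks_apply₁₂, fromBlocks_apply₂₁, fromBlocks_apply₂₂, Prod.mk.injEq, Pi.add_apply,
        Pi.smul_apply, hL, Matrix.add_apply, Pi.single_apply, Matrix.single_apply]
    · by_cases hi : i = r <;> by_cases hj : j = r <;> simp [hi, hj, @eq_comm _ r]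
    · by_cases hi : i = r <;> by_cases hj : j = r <;> simp [hi, hj, @eq_comm _ r]
    · simp
    · simp
  have hsymm : D + B + Matrix.single r r 2 =
      (2 : ℤ) • ((1 - shift (4 * n + 1)) * (1 - shift (4 * n + 1))ᵀ) := by
    rw [one_sub_shift_mul_transpose (by omega)]
    ext i j
    simp only [D, B, P, q, ρ, r, Matrix.add_apply, Matrix.sub_apply, Matrix.neg_apply, Matrix.smul_apply, diagonal_apply,
      Matrix.single_apply, transpose_apply, smul_eq_mul]
    split_ifs <;> ring
  have hanti : D - B = diagonal fun i => 2 * q i + 2 * ρ i := by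
    ext i j
    simp only [D, B, Matrix.sub_apply, Matrix.neg_apply, diagonal_apply]
    split_ifs <;> ring
  have hdet := G.det_lapMatrix_updateRow_add (r, false) (r, false) (r, true) 2
  rw [← det_submatrix_equiv_self e, hblocks, det_fromBlocks_add_left, hsymm, hanti, det_smul,
    det_mul, det_transpose, det_one_sub_shift, det_diagonal, Fintype.card_fin] at hdet
  simp only [mul_one] at hdet
  rw [hdet]
  norm_num [G]

theorem theorem3p4 (n : ℕ) (hn : 1 ≤ n) :
    numSpanningTrees (crossedNetwork n) = 2 ^ (10 * n + 2) * 3 ^ (2 * n - 1) := by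
  obtain ⟨k, rfl⟩ := Nat.exists_eq_add_of_le' hn
  have h := four_mul_numSpanningTrees_crossedNetwork (k + 1)
  rw [prod_antisymmetric_eigenvalues] at h
  have h576 : (576 : ℤ) ^ k = 2 ^ (6 * k) * 3 ^ (2 * k) := by
    rw [pow_mul, pow_mul, ← mul_pow]
    norm_num
  have h4 : (4 * numSpanningTrees (crossedNetwork (k + 1)) : ℤ) =
      4 * (2 ^ (10 * (k + 1) + 2) * 3 ^ (2 * k + 1)) := by
    rw [h, h576]
    ring
  rw [show 2 * (k + 1) - 1 = 2 * k + 1 by omega]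
  exact_mod_cast mul_left_cancel₀ (by norm_num : (4 : ℤ) ≠ 0) h4
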